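/- Let $n \ge 4$, and let $\mathbb{G}$ be a reflexive $n$-cycle, that is, a digraph with vertex set $\{0,1,\dots,n-1\}$ such that $(i,i)$ is an arc for every vertex $i$; for each $0 \le i < n-1$, one or both of the arcs $(i,i+1)$, $(i+1,i)$ is present; one or both of the arcs $(n-1,0)$, $(0,n-1)$ is present; and there are no other arcs. Then $\mathbb{G}$ is Słupecki, that is, all its surjective polymorphisms are essentially unary: for every integer $k \ge 1$ and every surjective map $f : \{0,\dots,n-1\}^k \to \{0,\dots,n-1\}$ such that $(f(x_1,\dots,x_k), f(y_1,\dots,y_k))$ is an arc of $\mathbb{G}$ whenever $(x_1,y_1),\dots,(x_k,y_k)$ are all arcs of $\mathbb{G}$, there exist an index $1 \le i \le k$ and a homomorphism $g : \mathbb{G} \to \mathbb{G}$ (a map on the vertices that sends arcs to arcs) such that $f(x_1,\dots,x_k) = g(x_i)$ for all $x_1,\dots,x_k \in \{0,\dots,n-1\}$. -/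

import Mathlib

namespace ReflexiveCycle

/-- A map between the vertex sets of two digraphs is a homomorphism if it preserves arcs. -/
def IsHom {V W : Type*} (G : Digraph V) (H : Digraph W) (f : V → W) : Prop :=
  ∀ ⦃x y : V⦄, G.Adj x y → H.Adj (f x) (f y)

/-- The `k`-th power of a digraph: arcs are taken coordinatewise. -/
def power {V : Type*} (G : Digraph V) (k : ℕ) : Digraph (Fin k → V) where
  Adj x y := ∀ i, G.Adj (x i) (y i)

/-- A `k`-ary polymorphism of `G` is a homomorphism from the `k`-th power of `G` to `G`. -/
def IsPolymorphism {V : Type*} (G : Digraph V) {k : ℕ} (f : (Fin k → V) → V) : Prop :=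
  IsHom (power G k) G f

/-- `f` is essentially unary: `f (x₁, …, x_k) = g (x_i)` for some coordinate `i` and some
endomorphism `g` of `G`. -/
def IsEssentiallyUnary {V : Type*} (G : Digraph V) {k : ℕ} (f : (Fin k → V) → V) : Prop :=
  ∃ (i : Fin k) (g : V → V), IsHom G G g ∧ ∀ x, f x = g (x i)

/-- A digraph is Słupecki if all its surjective polymorphisms, of any positive arity, are
essentially unary. -/
def IsSlupecki {V : Type*} (G : Digraph V) : Prop :=
  ∀ (k : ℕ), 1 ≤ k → ∀ f : (Fin k → V) → V,
    IsPolymorphism G f → Function.Surjective f → IsEssentiallyUnary G f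

/-- `j` is the cyclic successor of `i` on `{0, …, n - 1}`: either `j = i + 1`, or
`i = n - 1` and `j = 0`. -/
def IsNext {n : ℕ} (i j : Fin n) : Prop :=
  (i : ℕ) + 1 = j ∨ ((i : ℕ) + 1 = n ∧ (j : ℕ) = 0)

/-- A reflexive `n`-cycle on the vertex set `{0, …, n - 1}`: all loops are present, one or both
of the arcs between each vertex and its cyclic successor are present, and there are no other
arcs. -/
structure IsReflexiveCycle {n : ℕ} (G : Digraph (Fin n)) : Prop where
  refl : ∀ i, G.Adj i i
  edge : ∀ i j, IsNext i j → G.Adj i j ∨ G.Adj j i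
  only : ∀ i j, G.Adj i j → i = j ∨ IsNext i j ∨ IsNext j i

end ReflexiveCycle

/-! A polymorphism `f` of the cycle lifts to a polymorphism `F` of its universal cover, a reflexive
path on `ℤ` that is invariant under translation by `n`. Along each coordinate, `F` has a winding
number `w` with `|w| ≤ 1`.

If `w = ±1` for some coordinate, then `F` moves at unit speed in that direction, and sliding arcs
along it shows that `F` depends on no other coordinate.

If all winding numbers vanish, then `F` is `n`-periodic in every coordinate and attains a minimum
`m`. Consider the least length at which every alternating walk starting at `m` can advance by
`n - 1`. One step below this length some alternating walk cannot, although walks of its shape still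
connect all pairs of residue classes modulo `n`. Taking the image under `F` of such walks in each
coordinate, starting at a point where `F = m`, bounds all values of `F` by `m + n - 2`. So `F`
misses the residue class of `m - 1`, and `f` is not surjective. -/

namespace ReflexiveCycle

section Fence

variable {V W : Type*} {G : Digraph V} {H : Digraph W} {r k : ℕ}

/-- The digraph with all arcs reversed. -/
def reverse (G : Digraph V) : Digraph V where
  Adj x y := G.Adj y x

/-- `Fence G r x y`: there is a walk of length `r` from `x` to `y` along alternately oriented
arcs, the first of which points forward. The tail of a fence is a fence of `reverse G`, so that
`reverse^[s] G` records the orientation with which the `s`-th step is taken. -/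
def Fence : Digraph V → ℕ → V → V → Prop
  | _, 0, x, y => x = y
  | G, r + 1, x, y => ∃ z, G.Adj x z ∧ Fence (reverse G) r z y

lemma iterate_reverse_twice (G : Digraph V) (r : ℕ) : reverse^[r] (reverse^[r] G) = G := by
  rw [← Function.iterate_add_apply]
  exact congrFun (Function.Involutive.iterate_even (f := reverse) (fun _ => rfl) ⟨r, rfl⟩) G

lemma Fence.snoc {x y z : V} (h : Fence G r x y) (hyz : (reverse^[r] G).Adj y z) :
    Fence G (r + 1) x z := by
  induction r generalizing G x with
  | zero => exact ⟨z, h ▸ hyz, rfl⟩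
  | succ r ih =>
    obtain ⟨u, hxu, huy⟩ := h
    exact ⟨u, hxu, ih huy hyz⟩

lemma Fence.symm {x y : V} (h : Fence (reverse^[r] G) r x y) : Fence G r y x := by
  induction r generalizing x with
  | zero => exact Eq.symm h
  | succ r ih =>
    obtain ⟨u, hxu, huy⟩ := h
    rw [Function.iterate_succ_apply'] at hxu huy
    exact (ih huy).snoc hxu

lemma Fence.map {f : V → W} (hf : IsHom G H f) {x y : V} (h : Fence G r x y) :
    Fence H r (f x) (f y) := by
  induction r generalizing G H x with
  | zero => exact congrArg f h
  | succ r ih =>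
    obtain ⟨u, hxu, huy⟩ := h
    exact ⟨f u, hf hxu, ih (G := reverse G) (H := reverse H) (fun _ _ h => hf h) huy⟩

lemma Fence.pi {x y : Fin k → V} (h : ∀ i, Fence G r (x i) (y i)) : Fence (power G k) r x y := by
  induction r generalizing G x with
  | zero => exact funext h
  | succ r ih =>
    choose u hxu huy using h
    exact ⟨u, hxu, ih huy⟩

lemma IsPolymorphism.iterate_reverse {f : (Fin k → V) → V} (hf : IsPolymorphism G f) (s : ℕ) :
    IsPolymorphism (reverse^[s] G) f :=
  Function.Iterate.rec (IsPolymorphism · f) hf (f := reverse) (fun _ h _ _ hxy => h hxy) s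

end Fence

/-- A reflexive digraph on `ℤ` whose underlying graph is the two-way infinite path. -/
structure IsReflexiveLine (A : Digraph ℤ) : Prop where
  refl : ∀ z, A.Adj z z
  succ : ∀ z, A.Adj z (z + 1) ∨ A.Adj (z + 1) z
  near : ∀ y z, A.Adj y z → |y - z| ≤ 1

/-- A reflexive line that is invariant under translation by `n`: the universal cover of a reflexive
`n`-cycle. -/
structure IsPeriodicLine (n : ℕ) (A : Digraph ℤ) : Prop extends IsReflexiveLine A where
  adj_add : ∀ y z, A.Adj (y + n) (z + n) ↔ A.Adj y z

section Farthest

variable {A : Digraph ℤ} {n r : ℕ}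

protected lemma IsReflexiveLine.reverse (h : IsReflexiveLine A) : IsReflexiveLine (reverse A) :=
  ⟨h.refl, fun z => (h.succ z).symm, fun y z hyz => abs_sub_comm y z ▸ h.near z y hyz⟩

lemma IsPeriodicLine.iterate_reverse (h : IsPeriodicLine n A) (s : ℕ) :
    IsPeriodicLine n (reverse^[s] A) :=
  Function.Iterate.rec (IsPeriodicLine n) h (f := reverse)
    (fun _ h => ⟨h.toIsReflexiveLine.reverse, fun y z => h.adj_add z y⟩) s

open Classical in
/-- The rightmost end of an arc of the line `A` starting at `z`. -/
noncomputable def step (A : Digraph ℤ) (z : ℤ) : ℤ :=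
  if A.Adj z (z + 1) then z + 1 else z

/-- The rightmost end of a fence of length `r` in the line `A` starting at `z`. -/
noncomputable def farthest : Digraph ℤ → ℕ → ℤ → ℤ
  | _, 0, z => z
  | A, r + 1, z => farthest (reverse A) r (step A z)

lemma le_step (z : ℤ) : z ≤ step A z := by
  unfold step; split_ifs <;> lia

lemma step_le (z : ℤ) : step A z ≤ z + 1 := by
  unfold step; split_ifs <;> lia

lemma step_mono : Monotone (step A) := by
  intro y z hyz
  obtain rfl | hlt := hyz.eq_or_lt
  · exact le_rfl
  · exact (step_le y).trans ((Int.add_one_le_of_lt hlt).trans (le_step z))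

lemma farthest_mono (r : ℕ) : Monotone (farthest A r) := by
  induction r generalizing A with
  | zero => exact monotone_id
  | succ r ih => exact ih.comp step_mono

lemma le_farthest (r : ℕ) (z : ℤ) : z ≤ farthest A r z := by
  induction r generalizing A z with
  | zero => exact le_rfl
  | succ r ih => exact (le_step z).trans (ih _)

lemma farthest_le (r : ℕ) (z : ℤ) : farthest A r z ≤ z + r := by
  induction r generalizing A z with
  | zero => simp [farthest]
  | succ r ih =>
    have := step_le (A := A) z
    have := ih (A := reverse A) (step A z)
    push_cast
    exact this.trans (by lia)

lemma farthest_succ : ∀ (A : Digraph ℤ) (r : ℕ) (z : ℤ),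
    farthest A (r + 1) z = step (reverse^[r] A) (farthest A r z)
  | _, 0, _ => rfl
  | A, r + 1, z => farthest_succ (reverse A) r (step A z)

lemma Fence.le_farthest (h : IsReflexiveLine A) {y z : ℤ} (hyz : Fence A r y z) :
    z ≤ farthest A r y := by
  induction r generalizing A y with
  | zero => exact hyz.ge
  | succ r ih =>
    obtain ⟨u, hyu, huz⟩ := hyz
    have hu : u ≤ step A y := by
      have hnear := abs_le.1 (h.near y u hyu)
      by_cases hsucc : u = y + 1
      · rw [step, if_pos (hsucc ▸ hyu), hsucc]
      · exact (show u ≤ y by lia).trans (le_step y)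
    exact (ih h.reverse huz).trans (farthest_mono r hu)

namespace IsReflexiveLine

variable (h : IsReflexiveLine A)
include h

lemma adj_of_le_step {y z : ℤ} (hyz : y ≤ z) (hz : z ≤ step A y) : A.Adj y z := by
  unfold step at hz
  split_ifs at hz with hy
  · obtain rfl | rfl : z = y ∨ z = y + 1 := by lia
    · exact h.refl z
    · exact hy
  · exact le_antisymm hyz hz ▸ h.refl y

lemma fence_of_le_farthest {y z : ℤ} (hyz : y ≤ z) (hz : z ≤ farthest A r y) : Fence A r y z := by
  induction r generalizing A y with
  | zero => exact le_antisymm hyz hz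
  | succ r ih =>
    obtain hle | hlt := le_total (step A y) z
    · exact ⟨step A y, h.adj_of_le_step (le_step y) le_rfl, ih h.reverse hle hz⟩
    · exact ⟨z, h.adj_of_le_step hyz hlt, ih h.reverse le_rfl (le_farthest r z)⟩

lemma lt_farthest_two (z : ℤ) : z < farthest A 2 z := by
  change z < step (reverse A) (step A z)
  by_cases hz : A.Adj z (z + 1)
  · have : step A z = z + 1 := if_pos hz
    exact (this ▸ lt_add_one z).trans_le (le_step _)
  · have hz' : (reverse A).Adj z (z + 1) := (h.succ z).resolve_left hz
    rw [show step A z = z from if_neg hz, step, if_pos hz']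
    exact lt_add_one z

lemma add_le_farthest_two_mul (j : ℕ) (z : ℤ) : z + j ≤ farthest A (2 * j) z := by
  induction j generalizing z with
  | zero => simp [farthest]
  | succ j ih =>
    have htwo := h.lt_farthest_two z
    have hrest : farthest A 2 z + j ≤ farthest A (2 * (j + 1)) z := ih _
    push_cast
    lia

lemma add_one_lt_of_farthest_lt (hr : 2 ≤ r) {y z : ℤ} (hz : farthest A r y < z) :
    y + 1 < z := by
  obtain ⟨q, rfl⟩ := Nat.exists_eq_add_of_le hr
  have htwo : farthest A 2 y ≤ farthest A (2 + q) y := by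
    rw [add_comm]
    exact le_farthest (A := A) q (farthest A 2 y)
  have := h.lt_farthest_two y
  lia

/-- Walking `r` steps backwards takes `y`, hence also `N ≤ y`, only a short way. If `N` is within
reach of `x` there is room for one more step before this walk, and otherwise for one after it. Thus
a gap that fences of length `r` fail to cross in both directions makes some fence of length `r + 1`
advance by less than `n - 1`. -/
lemma exists_farthest_succ_le (hr : 2 ≤ r) {n : ℕ} {x y N : ℤ} (hxy : farthest A r x < y)
    (hyx : farthest (reverse^[r] A) r y < x + n) (hxN : x < N) (hNy : N ≤ y) :
    ∃ s, farthest (reverse^[s] A) (r + 1) N ≤ N + n - 2 := by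
  obtain hle | hlt := le_or_gt N (farthest A r x)
  · have hstep : step (reverse^[r + 1] A) N ≤ y := (step_le N).trans (by lia)
    have hback : farthest (reverse^[r + 1] A) (r + 1) N =
        farthest (reverse^[r] A) r (step (reverse^[r + 1] A) N) := by
      rw [farthest, ← Function.iterate_succ_apply' reverse]
      rfl
    have := farthest_mono (A := reverse^[r] A) r hstep
    exact ⟨r + 1, by lia⟩
  · have := h.add_one_lt_of_farthest_lt hr hlt
    have hmono := farthest_mono (A := reverse^[r] A) r hNy
    have hlast := step_le (A := reverse^[r] (reverse^[r] A)) (farthest (reverse^[r] A) r N)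
    rw [← farthest_succ] at hlast
    exact ⟨r, by lia⟩

end IsReflexiveLine

namespace IsPeriodicLine

lemma step_add (h : IsPeriodicLine n A) (z : ℤ) : step A (z + n) = step A z + n := by
  have hadj : A.Adj (z + n) (z + n + 1) ↔ A.Adj z (z + 1) := by
    rw [add_right_comm, h.adj_add]
  by_cases hz : A.Adj z (z + 1)
  · rw [step, step, if_pos hz, if_pos (hadj.2 hz), add_right_comm]
  · rw [step, step, if_neg hz, if_neg (mt hadj.1 hz)]

lemma farthest_add (h : IsPeriodicLine n A) (r : ℕ) (z : ℤ) :
    farthest A r (z + n) = farthest A r z + n := by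
  induction r generalizing A z with
  | zero => rfl
  | succ r ih => rw [farthest, h.step_add]; exact ih (h.iterate_reverse 1) _

lemma farthest_sub_periodic (h : IsPeriodicLine n A) (r : ℕ) :
    Function.Periodic (fun z => farthest A r z - z) (n : ℤ) := fun z => by
  simp only [h.farthest_add, add_sub_add_right_eq_sub]

lemma exists_critical_length (h : IsPeriodicLine n A) (hn : 4 ≤ n) (m : ℤ) :
    ∃ r, 2 ≤ r ∧ (∃ s, farthest (reverse^[s] A) r m ≤ m + n - 2) ∧
      ∀ s, m + n - 1 ≤ farthest (reverse^[s] A) (r + 1) m := by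
  classical
  have hex : ∃ r, ∀ s, m + n - 1 ≤ farthest (reverse^[s] A) r m := ⟨2 * n, fun s => by
    have := (h.iterate_reverse s).add_le_farthest_two_mul n m
    lia⟩
  have hfind := Nat.find_spec hex
  have hmin : ∀ r < Nat.find hex, ∃ s, farthest (reverse^[s] A) r m ≤ m + n - 2 := fun r hr => by
    obtain ⟨s, hs⟩ := not_forall.1 (Nat.find_min hex hr)
    exact ⟨s, by lia⟩
  have hlong : 3 ≤ Nat.find hex := by
    have := (hfind 0).trans (farthest_le _ m)
    lia
  refine ⟨Nat.find hex - 1, by lia, hmin _ (by lia), ?_⟩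
  rwa [Nat.sub_add_cancel (by lia)]

lemma exists_farthest_le_and_add_le_farthest (h : IsPeriodicLine n A) (hn : 4 ≤ n) (m : ℤ) :
    ∃ r s, farthest (reverse^[s] A) r m ≤ m + n - 2 ∧
      ∀ x y, farthest (reverse^[s] A) r x < y →
        x + n ≤ farthest (reverse^[r] (reverse^[s] A)) r y := by
  obtain ⟨r, hr, ⟨s, hs⟩, hlong⟩ := h.exists_critical_length hn m
  refine ⟨r, s, hs, fun x y hxy => ?_⟩
  by_contra! hyx
  set B := reverse^[s] A
  have hB : IsPeriodicLine n B := h.iterate_reverse s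
  obtain ⟨q, ⟨hxN, hNx⟩, -⟩ :=
    existsUnique_add_zsmul_mem_Ioc (show (0 : ℤ) < n by lia) m x
  have hshort : ∃ t, farthest (reverse^[t] B) (r + 1) (m + q • (n : ℤ)) ≤
      m + q • (n : ℤ) + n - 2 := by
    obtain hNy | hyN := le_or_gt (m + q • (n : ℤ)) y
    · exact hB.exists_farthest_succ_le hr hxy hyx hxN hNy
    · have hxy' : farthest (reverse^[r] (reverse^[r] B)) r (x + n) < y + n := by
        rw [iterate_reverse_twice, hB.farthest_add]
        lia
      obtain ⟨t, ht⟩ := (hB.iterate_reverse r).exists_farthest_succ_le hr hyx hxy' hyN hNx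
      exact ⟨t + r, by rwa [Function.iterate_add_apply]⟩
  obtain ⟨t, ht⟩ := hshort
  have hshift : farthest (reverse^[t] B) (r + 1) (m + q • (n : ℤ)) - (m + q • (n : ℤ)) =
      farthest (reverse^[t] B) (r + 1) m - m :=
    ((hB.iterate_reverse t).farthest_sub_periodic (r + 1)).zsmul q m
  have := hlong (t + s)
  rw [Function.iterate_add_apply] at this
  lia

lemma exists_fence_le_and_fence_modEq (h : IsPeriodicLine n A) (hn : 4 ≤ n) (m : ℤ) :
    ∃ r s, (∀ y, Fence (reverse^[s] A) r m y → y ≤ m + n - 2) ∧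
      ∀ x y : ℤ, ∃ x' y', x' ≡ x [ZMOD n] ∧ y' ≡ y [ZMOD n] ∧ Fence (reverse^[s] A) r x' y' := by
  obtain ⟨r, s, hm, hsep⟩ := h.exists_farthest_le_and_add_le_farthest hn m
  have hs : IsPeriodicLine n (reverse^[s] A) := h.iterate_reverse s
  have hrs : IsPeriodicLine n (reverse^[r] (reverse^[s] A)) := hs.iterate_reverse r
  refine ⟨r, s, fun y hy => (hy.le_farthest hs.toIsReflexiveLine).trans hm, fun x y => ?_⟩
  obtain ⟨q, ⟨hxy, hyx⟩, -⟩ := existsUnique_add_zsmul_mem_Ioc (show (0 : ℤ) < n by lia) y x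
  have hmod : y + q • (n : ℤ) ≡ y [ZMOD n] := by simp [Int.modEq_iff_dvd]
  obtain hle | hlt := le_or_gt (y + q • (n : ℤ)) (farthest (reverse^[s] A) r x)
  · exact ⟨x, _, rfl, hmod, hs.fence_of_le_farthest hxy.le hle⟩
  · exact ⟨x + n, _, Int.add_modEq_right, hmod,
      (hrs.fence_of_le_farthest hyx (hsep x _ hlt)).symm⟩

lemma exists_forall_not_modEq (h : IsPeriodicLine n A) (hn : 4 ≤ n) {k : ℕ} {F : (Fin k → ℤ) → ℤ}
    (hF : IsPolymorphism A F) (hper : ∀ x y, (∀ i, x i ≡ y i [ZMOD n]) → F x = F y) :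
    ∃ c, ∀ x, ¬ F x ≡ c [ZMOD n] := by
  have hn0 : (0 : ℤ) < n := by lia
  obtain ⟨x, hx⟩ : ∃ x, ∀ y, F x ≤ F y := by
    obtain ⟨x, -, hx⟩ := (Fintype.piFinset fun _ => Finset.Ico 0 (n : ℤ)).exists_min_image F
      ⟨0, Fintype.mem_piFinset.2 fun _ => Finset.mem_Ico.2 ⟨le_rfl, hn0⟩⟩
    refine ⟨x, fun y => ?_⟩
    rw [hper y (fun i => y i % n) fun i => (Int.mod_modEq _ _).symm]
    exact hx _ (by simp [Int.emod_nonneg _ hn0.ne', Int.emod_lt_of_pos _ hn0])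
  refine ⟨F x - 1, fun y hy => ?_⟩
  obtain ⟨r, s, hshort, hlong⟩ := h.exists_fence_le_and_fence_modEq hn (F x)
  choose x' y' hx' hy' hfence using fun i => hlong (x i) (y i)
  have hFfence : Fence (reverse^[s] A) r (F x') (F y') :=
    (Fence.pi hfence).map (hF.iterate_reverse s)
  rw [hper x' x hx', hper y' y hy'] at hFfence
  have hle := hshort _ hFfence
  have hge := hx y
  have hzero := Int.eq_zero_of_abs_lt_dvd (Int.modEq_iff_dvd.1 hy) (abs_lt.2 (by lia))
  lia

end IsPeriodicLine

end Farthest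

lemma periodic_of_forall_single {ι α : Type*} [Finite ι] [DecidableEq ι] {D : (ι → ℤ) → α}
    {v : ι → ℤ} (h : ∀ i, ∃ c, c ∣ v i ∧ Function.Periodic D (Pi.single i c)) :
    Function.Periodic D v := by
  have hsingle (i) : Function.Periodic D (Pi.single i (v i)) := by
    obtain ⟨c, ⟨q, hq⟩, hc⟩ := h i
    rw [hq, mul_comm, ← smul_eq_mul, Pi.single_smul']
    exact hc.zsmul q
  have := Fintype.ofFinite ι
  rw [← Finset.univ_sum_single v]
  induction (Finset.univ : Finset ι) using Finset.induction_on with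
  | empty => intro z; simp
  | insert i s hi ih =>
    rw [Finset.sum_insert hi]
    exact (hsingle i).add_period ih

lemma map_add_single {ι : Type*} [DecidableEq ι] {F : (ι → ℤ) → ℤ} {i : ι} {w : ℤ}
    (hFw : ∀ z, F (z + Pi.single i 1) = F z + w) (z : ι → ℤ) (t : ℤ) :
    F (z + Pi.single i t) = F z + t * w := by
  induction t using Int.induction_on with
  | zero => simp
  | succ t ih => rw [Pi.single_add, ← add_assoc, hFw, ih]; ring
  | pred t ih =>
    have := hFw (z + Pi.single i (-(t : ℤ) - 1))
    rw [add_assoc, ← Pi.single_add, sub_add_cancel, ih] at this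
    linarith

section Winding

variable {A : Digraph ℤ} {n k : ℕ} {F : (Fin k → ℤ) → ℤ} {i : Fin k} {w : ℤ}

lemma power_adj_add_single {x y : Fin k → ℤ} (hxy : ∀ j, j ≠ i → A.Adj (x j) (y j)) {s t : ℤ}
    (hst : A.Adj (x i + s) (y i + t)) :
    (power A k).Adj (x + Pi.single i s) (y + Pi.single i t) := by
  intro j
  by_cases hj : j = i
  · subst hj; simpa using hst
  · simpa [hj] using hxy j hj

namespace IsReflexiveLine

lemma power_adj_or_adj_add_single_one (h : IsReflexiveLine A) (z : Fin k → ℤ) (i : Fin k) :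
    (power A k).Adj z (z + Pi.single i 1) ∨ (power A k).Adj (z + Pi.single i 1) z := by
  refine (h.succ (z i)).imp (fun hz => ?_) (fun hz => ?_)
  · simpa using power_adj_add_single (i := i) (fun j _ => h.refl (z j)) (s := 0) (by simpa using hz)
  · simpa using power_adj_add_single (i := i) (fun j _ => h.refl (z j)) (t := 0) (by simpa using hz)

variable (h : IsReflexiveLine A) (hF : IsPolymorphism A F)
include h hF

lemma abs_map_add_single_sub_le (i : Fin k) (z : Fin k → ℤ) (j : ℕ) :
    |F (z + Pi.single i (j : ℤ)) - F z| ≤ j := by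
  have hunit (z : Fin k → ℤ) : |F (z + Pi.single i 1) - F z| ≤ 1 :=
    (h.power_adj_or_adj_add_single_one z i).elim
      (fun hz => abs_sub_comm (F z) _ ▸ h.near _ _ (hF hz))
      fun hz => h.near _ _ (hF hz)
  induction j with
  | zero => simp
  | succ j ih =>
    have hstep := hunit (z + Pi.single i (j : ℤ))
    rw [add_assoc, ← Pi.single_add] at hstep
    push_cast
    exact (abs_sub_le _ _ _).trans (add_comm (1 : ℤ) j ▸ add_le_add hstep ih)

lemma exists_winding_number (hn : 3 ≤ n)
    (hmod : ∀ x y, (∀ i, x i ≡ y i [ZMOD n]) → F x ≡ F y [ZMOD n]) (i : Fin k) :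
    ∃ w, ∀ z, F (z + Pi.single i (n : ℤ)) = F z + n * w := by
  have hdvd (z : Fin k → ℤ) : (n : ℤ) ∣ F (z + Pi.single i (n : ℤ)) - F z :=
    (hmod _ _ fun j => by
      by_cases hj : j = i
      · subst hj; simp [Int.modEq_iff_dvd]
      · simp [hj]).symm.dvd
  have hconst (v : Fin k → ℤ) :
      Function.Periodic (fun z => F (z + Pi.single i (n : ℤ)) - F z) v := by
    refine periodic_of_forall_single fun j => ⟨1, one_dvd _, fun z => ?_⟩
    have hz := h.abs_map_add_single_sub_le hF j z 1
    have hzn := h.abs_map_add_single_sub_le hF j (z + Pi.single i (n : ℤ)) 1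
    rw [add_right_comm, Nat.cast_one] at hzn
    refine sub_eq_zero.1 (Int.eq_zero_of_abs_lt_dvd (dvd_sub (hdvd _) (hdvd z)) ?_)
    rw [abs_le] at hz hzn
    push_cast at hz hzn
    exact abs_lt.2 (by lia)
  obtain ⟨w, hw⟩ := hdvd 0
  refine ⟨w, fun z => ?_⟩
  have := hconst z 0
  simp only [zero_add] at this
  rw [zero_add] at hw
  lia

lemma periodic_or_unit_speed (hn : 3 ≤ n)
    (hmod : ∀ x y, (∀ i, x i ≡ y i [ZMOD n]) → F x ≡ F y [ZMOD n]) (i : Fin k) :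
    Function.Periodic F (Pi.single i (n : ℤ)) ∨
      ∃ w : ℤ, w * w = 1 ∧ ∀ z, F (z + Pi.single i 1) = F z + w := by
  obtain ⟨w, hw⟩ := h.exists_winding_number hF hn hmod i
  have hle : |w| ≤ 1 := by
    have := h.abs_map_add_single_sub_le hF i 0 n
    rw [hw, add_sub_cancel_left, abs_mul, Nat.abs_cast] at this
    exact le_of_mul_le_mul_left (by simpa using this) (show (0 : ℤ) < n by lia)
  obtain rfl | hw1 : w = 0 ∨ w = 1 ∨ w = -1 := by
    rw [abs_le] at hle
    lia
  · exact Or.inl fun z => by simpa using hw z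
  · refine Or.inr ⟨w, by rcases hw1 with rfl | rfl <;> rfl, fun z => ?_⟩
    have hfirst := h.abs_map_add_single_sub_le hF i z 1
    have hrest := h.abs_map_add_single_sub_le hF i (z + Pi.single i 1) (n - 1)
    rw [add_assoc, ← Pi.single_add, Nat.cast_sub (by lia), Nat.cast_one, add_sub_cancel, hw]
      at hrest
    rw [abs_le] at hfirst hrest
    push_cast at hfirst
    rcases hw1 with rfl | rfl <;> lia

/-- With `F y = F x + e`, sliding the arc `x → y` along coordinate `i` shows that `u → u + e` is
an arc of `A` for every `u`, and then so is `u → u + e * w`. Shifting coordinate `i` of `y`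
by `e * w` therefore keeps the arc, and moves its image under `F` to `F x → F x + 2 * e`. -/
lemma eq_of_unit_speed_of_adj (hw : w * w = 1) (hFw : ∀ z, F (z + Pi.single i 1) = F z + w)
    {x y : Fin k → ℤ} (hxy : (power A k).Adj x y) (hi : x i = y i) : F x = F y := by
  have hslide {x y : Fin k → ℤ} (hxy : (power A k).Adj x y) {s t : ℤ}
      (hst : A.Adj (x i + s) (y i + t)) : A.Adj (F x + s * w) (F y + t * w) := by
    rw [← map_add_single hFw, ← map_add_single hFw]
    exact hF (power_adj_add_single (fun j _ => hxy j) hst)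
  obtain ⟨e, he⟩ : ∃ e, F y = F x + e := ⟨F y - F x, by ring⟩
  have hshift (u : ℤ) : A.Adj u (u + e) := by
    have := hslide hxy (s := w * (u - F x)) (t := w * (u - F x)) (hi ▸ h.refl _)
    convert this using 1
    · linear_combination (F x - u) * hw
    · linear_combination (F x - u) * hw - he
  have hshift' (u : ℤ) : A.Adj u (u + e * w) := by
    have := hslide (fun j => h.refl (x j)) (add_assoc (x i) _ _ ▸ hshift (x i + w * (u - F x)))
    convert this using 1
    · linear_combination (F x - u) * hw
    · linear_combination (F x - u) * hw
  have hdouble := h.near _ _ (hslide hxy (s := 0) (t := e * w) (by simpa [hi] using hshift' (y i)))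
  rw [he, mul_assoc, hw] at hdouble
  rw [abs_le] at hdouble
  lia

lemma eq_of_unit_speed_of_eq_at (hw : w * w = 1) (hFw : ∀ z, F (z + Pi.single i 1) = F z + w)
    {x y : Fin k → ℤ} (hi : x i = y i) : F x = F y := by
  have hstep (j : Fin k) (hj : j ≠ i) : Function.Periodic F (Pi.single j 1) := fun z => by
    have hij : (z + Pi.single j (1 : ℤ) : Fin k → ℤ) i = z i := by simp [hj.symm]
    obtain hz | hz := h.power_adj_or_adj_add_single_one z j
    · exact (h.eq_of_unit_speed_of_adj hF hw hFw hz hij.symm).symm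
    · exact h.eq_of_unit_speed_of_adj hF hw hFw hz hij
  have hperiod : Function.Periodic F (x - y) := by
    refine periodic_of_forall_single fun j => ?_
    by_cases hj : j = i
    · exact ⟨0, by simp [hj, hi], by simp [Function.Periodic]⟩
    · exact ⟨1, one_dvd _, hstep j hj⟩
  simpa using hperiod y

end IsReflexiveLine

lemma IsPeriodicLine.eq_of_eq_at_or_exists_forall_not_modEq (h : IsPeriodicLine n A) (hn : 4 ≤ n)
    (hF : IsPolymorphism A F) (hmod : ∀ x y, (∀ i, x i ≡ y i [ZMOD n]) → F x ≡ F y [ZMOD n]) :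
    (∃ i, ∀ x y, x i = y i → F x = F y) ∨ ∃ c, ∀ x, ¬ F x ≡ c [ZMOD n] := by
  by_cases hunit : ∃ i, ∃ w : ℤ, w * w = 1 ∧ ∀ z, F (z + Pi.single i 1) = F z + w
  · obtain ⟨i, w, hw, hFw⟩ := hunit
    exact Or.inl ⟨i, fun x y => h.eq_of_unit_speed_of_eq_at hF hw hFw⟩
  · have hperiodic (i : Fin k) : Function.Periodic F (Pi.single i (n : ℤ)) :=
      (h.periodic_or_unit_speed hF (by lia) hmod i).resolve_right (not_exists.1 hunit i)
    refine Or.inr (h.exists_forall_not_modEq hn hF fun x y hxy => ?_)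
    have : Function.Periodic F (x - y) :=
      periodic_of_forall_single fun i => ⟨n, (hxy i).symm.dvd, hperiodic i⟩
    simpa using this y

end Winding

section Lift

open Finset Fin.CommRing

lemma exists_antiderivative {M : Type*} [AddCommGroup M] (s : ℤ → M) (a : M) :
    ∃ L : ℤ → M, L 0 = a ∧ ∀ t, L (t + 1) = L t + s t := by
  refine ⟨fun t => a + ∑ i ∈ Ico 0 t, s i - ∑ i ∈ Ico t 0, s i, by simp, fun t => ?_⟩
  obtain ht | ht := lt_or_ge t 0
  · simp only [← insert_Ico_add_one_left_eq_Ico ht, Ico_eq_empty_of_le ht.le,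
      Ico_eq_empty_of_le (Int.add_one_le_of_lt ht), sum_empty, sum_insert,
      mem_Ico, Int.add_one_le_iff, lt_irrefl, false_and, not_false_eq_true]
    abel
  · simp only [← insert_Ico_right_eq_Ico_add_one ht, Ico_eq_empty_of_le ht,
      Ico_eq_empty_of_le (ht.trans (lt_add_one t).le), sum_empty, sum_insert right_notMem_Ico]
    abel

variable {n : ℕ} [NeZero n] {G : Digraph (Fin n)}

lemma isNext_iff {i j : Fin n} : IsNext i j ↔ j = i + 1 := by
  rw [IsNext, Fin.ext_iff, Fin.val_add, Fin.val_one', Nat.add_mod_mod]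
  obtain hi | hi := (Nat.succ_le_of_lt i.isLt).lt_or_eq
  · rw [Nat.mod_eq_of_lt hi]
    lia
  · rw [← Nat.succ_eq_add_one, hi, Nat.mod_self]
    lia

/-- The universal cover of a reflexive cycle on `Fin n`: the covering map is the reduction
`ℤ → Fin n` modulo `n`, and the condition `|y - z| ≤ 1` selects the arcs that lift arcs of `G`. -/
def cover (G : Digraph (Fin n)) : Digraph ℤ where
  Adj y z := |y - z| ≤ 1 ∧ G.Adj (y : Fin n) (z : Fin n)

namespace IsReflexiveCycle

variable (hG : IsReflexiveCycle G)
include hG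

lemma isPeriodicLine_cover : IsPeriodicLine n (cover G) where
  refl z := ⟨by simp, hG.refl z⟩
  succ z := (hG.edge z (z + 1 : ℤ) (isNext_iff.2 (by push_cast; rfl))).imp
    (fun hz => ⟨by simp, hz⟩) (fun hz => ⟨by simp, hz⟩)
  near _ _ h := h.1
  adj_add y z := by simp [cover]

lemma exists_eq_add {p q : Fin n} (h : G.Adj p q ∨ G.Adj q p) :
    ∃ e : ℤ, |e| ≤ 1 ∧ q = p + e := by
  have hcases : p = q ∨ q = p + 1 ∨ p = q + 1 := by
    obtain h | h := h
    · simpa only [isNext_iff] using hG.only p q h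
    · simpa only [isNext_iff, eq_comm, or_comm (a := p = q + 1)] using hG.only q p h
  obtain rfl | rfl | rfl := hcases
  · exact ⟨0, by simp⟩
  · exact ⟨1, by simp⟩
  · exact ⟨-1, by simp⟩

lemma abs_sub_le_one_of_triangle (hn : 4 ≤ n) {x y z : ℤ} (hxy : |x - y| ≤ 1)
    (hyz : |y - z| ≤ 1) (hadj : G.Adj (x : Fin n) (z : Fin n) ∨ G.Adj (z : Fin n) (x : Fin n)) :
    |x - z| ≤ 1 := by
  obtain ⟨e, he, hz⟩ := hG.exists_eq_add hadj
  rw [← Int.cast_add, CharP.intCast_eq_intCast (Fin n) n, Int.modEq_iff_dvd] at hz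
  rw [abs_le] at *
  have := Int.eq_zero_of_abs_lt_dvd hz (abs_lt.2 (by lia))
  lia

lemma abs_sub_le_one_of_square (hn : 4 ≤ n) {a b c d : ℤ} (hab : |a - b| ≤ 1)
    (hac : |a - c| ≤ 1) (hbd : |b - d| ≤ 1) (hcd : G.Adj (c : Fin n) (d : Fin n))
    (hdiag : G.Adj (a : Fin n) (d : Fin n) ∨ G.Adj (c : Fin n) (b : Fin n)) : |c - d| ≤ 1 := by
  rw [abs_sub_comm] at hac
  obtain had | hcb := hdiag
  · exact hG.abs_sub_le_one_of_triangle hn hac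
      (hG.abs_sub_le_one_of_triangle hn hab hbd (Or.inl had)) (Or.inl hcd)
  · exact hG.abs_sub_le_one_of_triangle hn
      (hG.abs_sub_le_one_of_triangle hn hac hab (Or.inl hcb)) hbd (Or.inl hcd)

lemma exists_path_lift {p : ℤ → Fin n} (hp : ∀ t, G.Adj (p t) (p (t + 1)) ∨ G.Adj (p (t + 1)) (p t))
    {a : ℤ} (ha : (a : Fin n) = p 0) :
    ∃ L : ℤ → ℤ, L 0 = a ∧ (∀ t, (L t : Fin n) = p t) ∧ ∀ t, |L t - L (t + 1)| ≤ 1 := by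
  choose e he hpe using fun t => hG.exists_eq_add (hp t)
  obtain ⟨L, hL0, hL⟩ := exists_antiderivative e a
  refine ⟨L, hL0, fun t => ?_, fun t => by simpa [hL] using he t⟩
  induction t using Int.induction_on with
  | zero => rw [hL0, ha]
  | succ t ih => rw [hL, hpe, Int.cast_add, ih]
  | pred t ih =>
    have hLt := hL (-t - 1)
    have hpt := hpe (-t - 1)
    rw [sub_add_cancel] at hLt hpt
    rwa [hLt, hpt, Int.cast_add, add_left_inj] at ih

lemma exists_lift_prod (hn : 4 ≤ n) {V : Type*} {H : Digraph V} (hH : ∀ x, H.Adj x x)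
    {f : V → ℤ → Fin n}
    (hf : ∀ ⦃x y s t⦄, H.Adj x y → (cover G).Adj s t → G.Adj (f x s) (f y t))
    {F₀ : V → ℤ} (hF₀ : IsHom H (cover G) F₀) (hF₀f : ∀ x, (F₀ x : Fin n) = f x 0) :
    ∃ F : V → ℤ → ℤ, (∀ x t, (F x t : Fin n) = f x t) ∧
      ∀ ⦃x y s t⦄, H.Adj x y → (cover G).Adj s t → (cover G).Adj (F x s) (F y t) := by
  have hline := hG.isPeriodicLine_cover
  choose F hF0 hFf hFsucc using fun x => hG.exists_path_lift
    (fun t => (hline.succ t).imp (hf (hH x)) (hf (hH x))) (hF₀f x)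
  have hlevel {x y : V} (hxy : H.Adj x y) (t : ℤ) : |F x t - F y t| ≤ 1 := by
    have hcd (t) : G.Adj (F x t : Fin n) (F y t) := by
      rw [hFf, hFf]; exact hf hxy (hline.refl t)
    have hdiag (t) : G.Adj (F x t : Fin n) (F y (t + 1)) ∨ G.Adj (F x (t + 1) : Fin n) (F y t) := by
      simp only [hFf]
      exact (hline.succ t).imp (hf hxy) (hf hxy)
    induction t using Int.induction_on with
    | zero => rw [hF0, hF0]; exact (hF₀ hxy).1
    | succ t ih =>
      exact hG.abs_sub_le_one_of_square hn ih (hFsucc x _) (hFsucc y _) (hcd _) (hdiag _)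
    | pred t ih =>
      have hx := hFsucc x (-t - 1)
      have hy := hFsucc y (-t - 1)
      have hd := hdiag (-t - 1)
      rw [sub_add_cancel] at hx hy hd
      rw [abs_sub_comm] at hx hy
      exact hG.abs_sub_le_one_of_square hn ih hx hy (hcd _) hd.symm
  refine ⟨F, hFf, fun x y s t hxy hst => ?_⟩
  have hadj : G.Adj (F x s : Fin n) (F y t) := by
    rw [hFf, hFf]; exact hf hxy hst
  refine ⟨?_, hadj⟩
  have hxst : |F x s - F x t| ≤ 1 := by
    have := abs_le.1 hst.1
    obtain rfl | rfl | rfl : s = t ∨ t = s + 1 ∨ s = t + 1 := by lia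
    · simp
    · exact hFsucc x s
    · exact abs_sub_comm (F x t) _ ▸ hFsucc x t
  exact hG.abs_sub_le_one_of_triangle hn hxst (hlevel hxy t) (Or.inl hadj)

lemma exists_lift (hn : 4 ≤ n) {k : ℕ} {f : (Fin k → ℤ) → Fin n}
    (hf : IsHom (power (cover G) k) G f) :
    ∃ F : (Fin k → ℤ) → ℤ, (∀ x, (F x : Fin n) = f x) ∧ IsPolymorphism (cover G) F := by
  have hline := hG.isPeriodicLine_cover
  induction k with
  | zero =>
    refine ⟨fun x => (f x : ℕ), fun x => by simp, fun x y _ => ?_⟩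
    rw [Subsingleton.elim x y]
    exact hline.refl _
  | succ k ih =>
    have hcons ⦃x y : Fin k → ℤ⦄ ⦃s t : ℤ⦄ (hxy : (power (cover G) k).Adj x y)
        (hst : (cover G).Adj s t) : G.Adj (f (Fin.cons s x)) (f (Fin.cons t y)) :=
      hf (Fin.cases hst hxy)
    obtain ⟨F₀, hF₀f, hF₀⟩ := ih fun x y hxy => hcons hxy (hline.refl 0)
    obtain ⟨F, hFf, hF⟩ := hG.exists_lift_prod hn (H := power (cover G) k)
      (fun x i => hline.refl (x i)) hcons hF₀ hF₀f
    refine ⟨fun x => F (Fin.tail x) (x 0), fun x => ?_, fun x y hxy =>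
      hF (fun i => hxy i.succ) (hxy 0)⟩
    rw [hFf, Fin.cons_self_tail]

end IsReflexiveCycle

end Lift

end ReflexiveCycle

open ReflexiveCycle Fin.CommRing in
theorem theorem1p1 (n : ℕ) (hn : 4 ≤ n) (G : Digraph (Fin n))
    (hG : ReflexiveCycle.IsReflexiveCycle G) : ReflexiveCycle.IsSlupecki G := by
  intro k _ f hf hsurj
  have : NeZero n := ⟨by lia⟩
  obtain ⟨F, hFf, hF⟩ := hG.exists_lift hn (f := fun x => f fun i => (x i : Fin n))
    fun x y hxy => hf fun i => (hxy i).2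
  have hFf' (x : Fin k → Fin n) : (F fun i => (x i : ℕ) : Fin n) = f x := by simp [hFf]
  have hmod (x y : Fin k → ℤ) (hxy : ∀ i, x i ≡ y i [ZMOD n]) : F x ≡ F y [ZMOD n] := by
    simp only [← CharP.intCast_eq_intCast (Fin n) n] at hxy ⊢
    simp only [hFf, hxy]
  obtain ⟨i, hi⟩ | ⟨c, hc⟩ :=
    hG.isPeriodicLine_cover.eq_of_eq_at_or_exists_forall_not_modEq hn hF hmod
  · refine ⟨i, fun t => f fun _ => t, fun s t hst => hf fun _ => hst, fun x => ?_⟩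
    calc f x = (F fun j => (x j : ℕ) : Fin n) := (hFf' x).symm
      _ = (F fun _ => (x i : ℕ) : Fin n) := congrArg _ (hi _ _ rfl)
      _ = f fun _ => x i := hFf' _
  · obtain ⟨x, hx⟩ := hsurj c
    exact absurd ((CharP.intCast_eq_intCast (Fin n) n).1 ((hFf' x).trans hx)) (hc _)
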